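/- Let $\Omega=(-1,1)$, $u^\delta\in L^2(\Omega)$ and $\lambda_1,\lambda_2\ge 0$. For $u\in L^2(\Omega)$ put $$\mathcal S(u)=\tfrac12\int_{-1}^1 (u-u^\delta)^2\,dx,\qquad \mathrm{TGV}(u)=\sup\Big\{\int_{-1}^1 u\,\phi''\,dx:\ \phi\in C_c^\infty(-1,1),\ \|\phi'\|_{L^\infty}\le\lambda_1,\ \|\phi\|_{L^\infty}\le\lambda_2\Big\}.$$ For a functional $\mathcal R$ on $L^2(\Omega)$ let $\mathcal R^*(w)=\sup_{v\in L^2(\Omega)}\{\int_{-1}^1 wv\,dx-\mathcal R(v)\}$ be its Fenchel dual, and for $w\in L^2(\Omega)$ let $\sigma^1[w](x)=\int_{-1}^x w\,dt$ and $\sigma^2[w](x)=\int_{-1}^x\sigma^1[w]\,dt$. Let $u$ minimize $\mathcal S+\mathrm{TGV}$ over $L^2(\Omega)$ and let $u^*$ minimize $w\mapsto \mathcal S^*(w)+\mathrm{TGV}^*(-w)$ over $L^2(\Omega)$. Write $\sigma^i=\sigma^i[u^*]$. Then $u^*=u-u^\delta$, and the following hold, where equalities of $u$ with other functions are meant almost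 everywhere. 1. On each connected component of $B=\{x\in\Omega: |\sigma^1(x)|<\lambda_1 \text{ and } |\sigma^2(x)|<\lambda_2\}$, $u$ is a polynomial of degree at most $1$. 2. If $A\subseteq\Omega$ is an interval such that $|\sigma^1|=\lambda_1$ on all of $A$, or $|\sigma^2|=\lambda_2$ on all of $A$, then $u=u^\delta$ on $A$. 3. (Jump condition) Let $x_0\in\Omega$ and $\epsilon>0$ be such that $|\sigma^1(x)|<\lambda_1$ for all $x\in \Omega$ with $0<|x-x_0|<\epsilon$, and suppose $\sigma^1(x_0)=\lambda_1$. Let $J$ be the connected component containing $x_0$ of $\{x\in\Omega:\ |x-x_0|<\epsilon,\ |\sigma^2(x)|<\lambda_2\}$. Then $J$ is a neighbourhood of $x_0$, and there are constants $c_1$ and $d_1\le d_2$ such that $u(x)=c_1x+d_1$ for $x\in J$, $x<x_0$, and $u(x)=c_1x+d_2$ for $x\in J$, $x>x_0$. If instead $\sigma^1(x_0)=-\lambda_1$, the same holds with $d_2\le d_1$. 4. (Bending condition) Let $x_0\in\Omega$ and $\epsilon>0$ be such that $|\sigma^2(x)|<\lambda_2$ for all $x\in\Omega$ with $0<|x-x_0|<\epsilon$,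 and suppose $\sigma^2(x_0)=\lambda_2$. Let $J$ be the connected component containing $x_0$ of $\{x\in\Omega:\ |x-x_0|<\epsilon,\ |\sigma^1(x)|<\lambda_1\}$. Then $J$ is a neighbourhood of $x_0$, and there are constants $c_1,d_1,c_2,d_2$ with $c_2\le c_1$ and $c_1x_0+d_1=c_2x_0+d_2$ (so $u$ is continuous at $x_0$) such that $u(x)=c_1x+d_1$ for $x\in J$, $x<x_0$, and $u(x)=c_2x+d_2$ for $x\in J$, $x>x_0$. If instead $\sigma^2(x_0)=-\lambda_2$, the same holds with $c_1\le c_2$. In particular, if in 3 (in 4) also $|\sigma^2|<\lambda_2$ ($|\sigma^1|<\lambda_1$) on all of $\Omega\cap(x_0-\epsilon,x_0+\epsilon)$, then the stated form of $u$ holds on all of $\Omega\cap(x_0-\epsilon,x_0+\epsilon)$. -/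

import Mathlib

open MeasureTheory Set Topology
open scoped ContDiff

noncomputable section

namespace TGV1D

/-- The domain `Ω = (-1, 1)`. -/
def Ω : Set ℝ := Ioo (-1) 1

/-- The real Hilbert space `L²(-1, 1)`. -/
abbrev L2 : Type := Lp ℝ 2 (volume.restrict Ω)

/-- The Fenchel dual `S*(w) = sup_u (⟨w, u⟩ - S(u))` of an extended real functional on a real
Hilbert space (identified with its dual). -/
def fenchelDual {H : Type*} [NormedAddCommGroup H] [InnerProductSpace ℝ H]
    (S : H → EReal) (w : H) : EReal :=
  ⨆ u : H, ((inner ℝ w u : ℝ) : EReal) - S u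

/-- The data term `S(u) = ½ ∫_{-1}^{1} (u - uδ)² dx`. -/
def dataTerm (uδ : L2) (u : L2) : EReal :=
  (((1 / 2 : ℝ) * ∫ x in Ω, (u x - uδ x) ^ 2 : ℝ) : EReal)

/-- The test functions `φ ∈ C_c^∞(-1, 1)` with `‖φ'‖_∞ ≤ l₁` and `‖φ‖_∞ ≤ l₂`. -/
structure IsTest (l₁ l₂ : ℝ) (φ : ℝ → ℝ) : Prop where
  smooth : ContDiff ℝ ∞ φ
  compact : HasCompactSupport φ
  support : tsupport φ ⊆ Ω
  deriv_le : ∀ x ∈ Ω, |deriv φ x| ≤ l₁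
  le : ∀ x ∈ Ω, |φ x| ≤ l₂

/-- `TGV_{l₁,l₂}(u) = sup ∫_{-1}^{1} u φ'' dx` over the test functions above. -/
def tgv (l₁ l₂ : ℝ) (u : L2) : EReal :=
  ⨆ (φ : ℝ → ℝ) (_ : IsTest l₁ l₂ φ),
    ((∫ x in Ω, u x * iteratedDeriv 2 φ x : ℝ) : EReal)

/-- The primal functional `u ↦ S(u) + TGV(u)`. -/
def primal (l₁ l₂ : ℝ) (uδ : L2) (u : L2) : EReal :=
  dataTerm uδ u + tgv l₁ l₂ u

/-- The dual functional `w ↦ S*(w) + TGV*(-w)`. -/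
def dual (l₁ l₂ : ℝ) (uδ : L2) (w : L2) : EReal :=
  fenchelDual (dataTerm uδ) w + fenchelDual (tgv l₁ l₂) (-w)

/-- Iterated primitives: `σ⁰[w] = w` and `σ^{i+1}[w](x) = ∫_{-1}^{x} σ^i[w](t) dt`.
They are used only at points of `(-1, 1)`. -/
def σ : ℕ → (ℝ → ℝ) → ℝ → ℝ
  | 0, w => w
  | i + 1, w => fun x => ∫ t in (-1 : ℝ)..x, σ i w t

/-- On `J`, the function `u` equals (almost everywhere) `c₁ x + d₁` to the left of `x₀` and
`c₂ x + d₂` to the right of `x₀`. -/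
def EqTwoAffine (u : ℝ → ℝ) (J : Set ℝ) (x₀ c₁ d₁ c₂ d₂ : ℝ) : Prop :=
  (∀ᵐ x : ℝ, x ∈ J → x < x₀ → u x = c₁ * x + d₁) ∧
  (∀ᵐ x : ℝ, x ∈ J → x₀ < x → u x = c₂ * x + d₂)

/-- The connected component containing `x₀` of the set of those `x ∈ (x₀ - ε, x₀ + ε) ∩ (-1, 1)`
with `|f x| < l` (empty if `x₀` is not in that set). -/
def comp (f : ℝ → ℝ) (l x₀ ε : ℝ) : Set ℝ :=
  connectedComponentIn {x | x ∈ Ioo (x₀ - ε) (x₀ + ε) ∩ Ω ∧ |f x| < l} x₀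

end TGV1D

end

/-! TGV is the support function of the symmetric convex set `K` of second derivatives of test
functions, so the primal problem is a projection: if `p` is the point of `closure K` nearest to
`uδ`, then `u = uδ - p` and the dual minimizer is `w = -p` (`exists_mem_closure_of_isMinOn`). By
symmetry `w` lies in `closure K`, and it minimizes the pairing with `u` there.

For `k = ψ''` in `K` the primitives are `σ¹[k] = ψ'` and `σ²[k] = ψ`, and they depend on `k`
continuously from L² to the uniform norm. Hence `|σ¹[w]| ≤ l₁` and `|σ²[w]| ≤ l₂`, and a small
multiple of `η''` may be added to `w` whenever `η'` and `η` do not point outwards near contact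
points. Minimality then gives `0 ≤ ∫ u η''` (`integral_mul_deriv_deriv_nonneg`).

Away from contact both `η` and `-η` are allowed, so `u'' = 0` weakly and `u` is affine. At an
isolated contact point `u` has two affine pieces, and `∫ u η''` equals (change of slope) `* η x₀`
minus (jump) `* η' x₀`; suitable germs of `η` at `x₀` yield the jump and bending conditions. Since
`σ²` has derivative `σ¹`, contact of `σ²` forces `σ¹ = 0` there, which separates the two kinds of
contact. On a saturated interval the same extremum argument gives `w = 0`. -/

namespace TGV1D

/-! ### Convex duality in Hilbert space -/

/-- Moreau decomposition: the minimizers of `½‖· - d‖² + T` and of the dual functional, where `T`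
is the support function of a convex set `K`. -/
theorem exists_mem_closure_of_isMinOn {H : Type*} [NormedAddCommGroup H] [InnerProductSpace ℝ H]
    [CompleteSpace H] {K : Set H} (hK : Convex ℝ K) (hne : K.Nonempty) {d u w : H}
    {S T : H → EReal} (hS : ∀ v, S v = ((1 / 2 * ‖v - d‖ ^ 2 : ℝ) : EReal))
    (hT : ∀ v, T v = ⨆ k ∈ K, ((inner ℝ v k : ℝ) : EReal))
    (hu : IsMinOn (fun v => S v + T v) univ u)
    (hw : IsMinOn (fun v => fenchelDual S v + fenchelDual T (-v)) univ w) :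
    ∃ p ∈ closure K, u = d - p ∧ w = -p ∧ ∀ k ∈ K, inner ℝ u k ≤ inner ℝ u p := by
  obtain ⟨p, hp, hmin⟩ := exists_norm_eq_iInf_of_complete_convex hne.closure
    isClosed_closure.isComplete hK.closure d
  have hproj : ∀ k ∈ K, inner ℝ (d - p) k ≤ inner ℝ (d - p) p := fun k hk => by
    have := (norm_eq_iInf_iff_real_inner_le_zero hK.closure hp).1 hmin k (subset_closure hk)
    rw [inner_sub_right] at this
    linarith
  -- `T` is a supremum over `K` only; the bound reaches `p` because it is a closed condition on `k`.
  have hTle : ∀ v : H, ((inner ℝ v p : ℝ) : EReal) ≤ T v := fun v => by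
    have hclosed : IsClosed {k : H | ((inner ℝ v k : ℝ) : EReal) ≤ T v} :=
      isClosed_le (continuous_coe_real_ereal.comp (by fun_prop)) continuous_const
    refine closure_minimal (fun k hk => ?_) hclosed hp
    rw [mem_ofPred_eq, hT]
    exact le_iSup₂ (f := fun k _ => ((inner ℝ v k : ℝ) : EReal)) k hk
  have hTu : T (d - p) ≤ ((inner ℝ (d - p) p : ℝ) : EReal) := by
    rw [hT]
    exact iSup₂_le fun k hk => EReal.coe_le_coe_iff.2 (hproj k hk)
  have hu' : u = d - p := by
    have h1 : S u + ((inner ℝ u p : ℝ) : EReal) ≤ S (d - p) + ((inner ℝ (d - p) p : ℝ) : EReal) :=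
      ((add_le_add le_rfl (hTle u)).trans (isMinOn_iff.1 hu (d - p) (mem_univ _))).trans
        (add_le_add le_rfl hTu)
    rw [hS, hS, ← EReal.coe_add, ← EReal.coe_add, EReal.coe_le_coe_iff] at h1
    -- In terms of the deviation `e` the linear terms cancel and `h1` reduces to `½‖e‖² ≤ 0`.
    obtain ⟨e, rfl⟩ : ∃ e, u = d - p + e := ⟨u - (d - p), by abel⟩
    rw [show d - p + e - d = e - p by abel, show d - p - d = -p by abel, norm_neg,
      norm_sub_sq_real, inner_add_left] at h1
    have : ‖e‖ ^ 2 ≤ 0 := by linarith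
    simpa using this
  have hw' : w = -p := by
    -- The conjugate of `S` is exactly `½‖v‖² + ⟨v, d⟩`, attained at `v + d`. For the conjugate of
    -- `T`, an upper bound at `p` and the trial point `d - p` suffice: comparing `w` with `-p`
    -- leaves `½‖w + p‖² ≤ 0`.
    have hSdual : ∀ v : H, fenchelDual S v ≤
        ((1 / 2 * ‖v‖ ^ 2 + inner ℝ v d : ℝ) : EReal) := fun v => iSup_le fun x => by
      rw [hS, ← EReal.coe_sub, EReal.coe_le_coe_iff]
      have := norm_sub_sq_real v (x - d)
      rw [inner_sub_right] at this
      nlinarith [sq_nonneg ‖v - (x - d)‖]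
    have hSdual' : ∀ v : H, ((1 / 2 * ‖v‖ ^ 2 + inner ℝ v d : ℝ) : EReal) ≤
        fenchelDual S v := fun v => by
      refine le_trans (le_of_eq ?_)
        (le_iSup (fun x => ((inner ℝ v x : ℝ) : EReal) - S x) (v + d))
      rw [hS, ← EReal.coe_sub, EReal.coe_eq_coe_iff, inner_add_right, add_sub_cancel_right,
        real_inner_self_eq_norm_sq]
      ring
    have hTdual : fenchelDual T (- -p) ≤ ((0 : ℝ) : EReal) := iSup_le fun x => by
      rw [neg_neg, real_inner_comm]
      refine (EReal.sub_le_sub le_rfl (hTle x)).trans ?_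
      rw [← EReal.coe_sub, sub_self]
    have hTdual' : ((inner ℝ (-w) (d - p) - inner ℝ (d - p) p : ℝ) : EReal) ≤
        fenchelDual T (-w) := by
      refine le_trans ?_ (le_iSup (fun x => ((inner ℝ (-w) x : ℝ) : EReal) - T x) (d - p))
      rw [EReal.coe_sub]
      exact EReal.sub_le_sub le_rfl hTu
    have h1 := ((add_le_add (hSdual' w) hTdual').trans
      (isMinOn_iff.1 hw (-p) (mem_univ _))).trans (add_le_add (hSdual (-p)) hTdual)
    rw [← EReal.coe_add, ← EReal.coe_add, EReal.coe_le_coe_iff] at h1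
    have h2 := norm_add_sq_real w p
    simp only [norm_neg, inner_neg_left, inner_sub_left, inner_sub_right,
      real_inner_self_eq_norm_sq, real_inner_comm p d] at h1 h2
    have : ‖w + p‖ ^ 2 ≤ 0 := by linarith
    exact eq_neg_of_add_eq_zero_left (by simpa using this)
  exact ⟨p, hp, hu', hw', hu' ▸ hproj⟩

/-! ### TGV as a support function -/

theorem measurableSet_Ω : MeasurableSet Ω := measurableSet_Ioo

theorem dataTerm_eq (uδ v : L2) : dataTerm uδ v = ((1 / 2 * ‖v - uδ‖ ^ 2 : ℝ) : EReal) := by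
  rw [dataTerm, ← real_inner_self_eq_norm_sq, L2.inner_def]
  congr 2
  refine integral_congr_ae ?_
  filter_upwards [Lp.coeFn_sub v uδ] with x hx
  simp only [RCLike.inner_apply, conj_trivial]
  rw [hx, Pi.sub_apply]
  ring

/-- The second derivatives of the test functions, as elements of `L²`. -/
def secondDerivs (l₁ l₂ : ℝ) : Set L2 :=
  {k | ∃ φ, IsTest l₁ l₂ φ ∧ k =ᵐ[volume.restrict Ω] deriv (deriv φ)}

theorem _root_.ContDiff.smooth_deriv {η : ℝ → ℝ} (h : ContDiff ℝ ∞ η) : ContDiff ℝ ∞ (deriv η) :=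
  (contDiff_infty_iff_deriv.1 h).2

theorem exists_L2_ae_eq_deriv_deriv {η : ℝ → ℝ} (h : ContDiff ℝ ∞ η) (hc : HasCompactSupport η) :
    ∃ k : L2, k =ᵐ[volume.restrict Ω] deriv (deriv η) :=
  have hm : MemLp (deriv (deriv η)) 2 (volume.restrict Ω) :=
    (h.smooth_deriv.smooth_deriv.continuous.memLp_of_hasCompactSupport hc.deriv.deriv)
  ⟨hm.toLp, hm.coeFn_toLp⟩

theorem inner_eq_integral {u k : L2} {f : ℝ → ℝ} (hk : k =ᵐ[volume.restrict Ω] f) :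
    inner ℝ u k = ∫ x in Ω, u x * f x := by
  rw [L2.inner_def]
  refine integral_congr_ae ?_
  filter_upwards [hk] with x hx
  simp [hx, mul_comm]

theorem tgv_eq (l₁ l₂ : ℝ) (v : L2) :
    tgv l₁ l₂ v = ⨆ k ∈ secondDerivs l₁ l₂, ((inner ℝ v k : ℝ) : EReal) := by
  simp only [tgv, iteratedDeriv_succ, iteratedDeriv_zero]
  refine le_antisymm (iSup₂_le fun φ hφ => ?_) (iSup₂_le fun k hk => ?_)
  · obtain ⟨k, hk⟩ := exists_L2_ae_eq_deriv_deriv hφ.smooth hφ.compact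
    rw [← inner_eq_integral hk]
    exact le_iSup₂ (f := fun k (_ : k ∈ secondDerivs l₁ l₂) => ((inner ℝ v k : ℝ) : EReal))
      k ⟨φ, hφ, hk⟩
  · obtain ⟨φ, hφ, hk⟩ := hk
    rw [inner_eq_integral hk]
    exact le_iSup₂ (f := fun φ (_ : IsTest l₁ l₂ φ) =>
      ((∫ x in Ω, v x * deriv (deriv φ) x : ℝ) : EReal)) φ hφ

theorem deriv_lin {f g : ℝ → ℝ} (hf : ContDiff ℝ ∞ f) (hg : ContDiff ℝ ∞ g) (a b : ℝ) :
    deriv (fun x => a * f x + b * g x) = fun x => a * deriv f x + b * deriv g x := by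
  ext x
  exact (((hf.differentiable (by simp) x).hasDerivAt.const_mul a).add
    ((hg.differentiable (by simp) x).hasDerivAt.const_mul b)).deriv

theorem deriv_deriv_lin {f g : ℝ → ℝ} (hf : ContDiff ℝ ∞ f) (hg : ContDiff ℝ ∞ g) (a b : ℝ) :
    deriv (deriv fun x => a * f x + b * g x) =
      fun x => a * deriv (deriv f) x + b * deriv (deriv g) x := by
  rw [deriv_lin hf hg, deriv_lin hf.smooth_deriv hg.smooth_deriv]

theorem hasCompactSupport_lin {f g : ℝ → ℝ} (hf : HasCompactSupport f) (hg : HasCompactSupport g)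
    (a b : ℝ) : HasCompactSupport fun x => a * f x + b * g x :=
  (hf.mul_left (f := fun _ => a)).add (hg.mul_left (f := fun _ => b))

theorem tsupport_lin_subset {f g : ℝ → ℝ} {U : Set ℝ} (hf : tsupport f ⊆ U) (hg : tsupport g ⊆ U)
    (a b : ℝ) : tsupport (fun x => a * f x + b * g x) ⊆ U := by
  refine (tsupport_add (fun x => a * f x) (fun x => b * g x)).trans (union_subset ?_ ?_)
  · exact (tsupport_mul_subset_right (f := fun _ => a)).trans hf
  · exact (tsupport_mul_subset_right (f := fun _ => b)).trans hg

theorem lin_ae_eq {k h : L2} {f g : ℝ → ℝ} (hk : k =ᵐ[volume.restrict Ω] f)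
    (hh : h =ᵐ[volume.restrict Ω] g) (a b : ℝ) :
    (a • k + b • h : L2) =ᵐ[volume.restrict Ω] fun x => a * f x + b * g x := by
  filter_upwards [Lp.coeFn_add (a • k) (b • h), Lp.coeFn_smul a k, Lp.coeFn_smul b h, hk, hh]
    with x h1 h2 h3 h4 h5
  rw [h1, Pi.add_apply, h2, h3, Pi.smul_apply, Pi.smul_apply, h4, h5, smul_eq_mul, smul_eq_mul]

theorem convex_secondDerivs (l₁ l₂ : ℝ) : Convex ℝ (secondDerivs l₁ l₂) := by
  rintro k ⟨φ, hφ, hk⟩ h ⟨ψ, hψ, hh⟩ a b ha hb hab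
  have aux : ∀ {y z l : ℝ}, |y| ≤ l → |z| ≤ l → |a * y + b * z| ≤ l := fun {y z l} hy hz => by
    calc |a * y + b * z| ≤ |a * y| + |b * z| := abs_add_le _ _
      _ = a * |y| + b * |z| := by rw [abs_mul, abs_mul, abs_of_nonneg ha, abs_of_nonneg hb]
      _ ≤ a * l + b * l := by gcongr
      _ = l := by rw [← add_mul, hab, one_mul]
  refine ⟨fun x => a * φ x + b * ψ x, ⟨?_, hasCompactSupport_lin hφ.compact hψ.compact a b,
    tsupport_lin_subset hφ.support hψ.support a b, fun x hx => ?_, fun x hx => ?_⟩, ?_⟩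
  · exact (contDiff_const.mul hφ.smooth).add (contDiff_const.mul hψ.smooth)
  · rw [deriv_lin hφ.smooth hψ.smooth]
    exact aux (hφ.deriv_le x hx) (hψ.deriv_le x hx)
  · exact aux (hφ.le x hx) (hψ.le x hx)
  · rw [deriv_deriv_lin hφ.smooth hψ.smooth]
    exact lin_ae_eq hk hh a b

theorem nonempty_secondDerivs {l₁ l₂ : ℝ} (hl₁ : 0 ≤ l₁) (hl₂ : 0 ≤ l₂) :
    (secondDerivs l₁ l₂).Nonempty := by
  have h0 : IsTest l₁ l₂ (0 : ℝ → ℝ) := ⟨contDiff_const, HasCompactSupport.zero, by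
    simp [tsupport], by simpa using fun _ _ => hl₁, by simpa using fun _ _ => hl₂⟩
  obtain ⟨k, hk⟩ := exists_L2_ae_eq_deriv_deriv h0.smooth h0.compact
  exact ⟨k, 0, h0, hk⟩

theorem neg_mem_secondDerivs {l₁ l₂ : ℝ} {k : L2} (hk : k ∈ secondDerivs l₁ l₂) :
    -k ∈ secondDerivs l₁ l₂ := by
  obtain ⟨φ, hφ, hk⟩ := hk
  have hd : deriv (-φ) = -deriv φ := funext fun x => deriv.neg
  refine ⟨-φ, ⟨hφ.smooth.neg, hφ.compact.neg, ?_, fun x hx => ?_, fun x hx => ?_⟩, ?_⟩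
  · rw [tsupport, Function.support_neg]; exact hφ.support
  · rw [hd, Pi.neg_apply, abs_neg]; exact hφ.deriv_le x hx
  · rw [Pi.neg_apply, abs_neg]; exact hφ.le x hx
  · have hd' : deriv (-deriv φ) = -deriv (deriv φ) := funext fun x => deriv.neg
    rw [hd, hd']
    exact (Lp.coeFn_neg k).trans hk.neg

/-- Both minimizers are determined by the projection of the data onto the closure of the second
derivatives of test functions. -/
theorem optimality {l₁ l₂ : ℝ} (hl₁ : 0 ≤ l₁) (hl₂ : 0 ≤ l₂) {uδ u w : L2}
    (hu : IsMinOn (primal l₁ l₂ uδ) univ u) (hw : IsMinOn (dual l₁ l₂ uδ) univ w) :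
    w = u - uδ ∧ w ∈ closure (secondDerivs l₁ l₂) ∧
      ∀ k ∈ secondDerivs l₁ l₂, inner ℝ u w ≤ inner ℝ u k := by
  obtain ⟨p, hp, rfl, rfl, h⟩ := exists_mem_closure_of_isMinOn (convex_secondDerivs l₁ l₂)
    (nonempty_secondDerivs hl₁ hl₂) (dataTerm_eq uδ) (tgv_eq l₁ l₂) hu hw
  refine ⟨by abel, ?_, fun k hk => ?_⟩
  · exact map_mem_closure continuous_neg hp fun k hk => neg_mem_secondDerivs hk
  · have := h _ (neg_mem_secondDerivs hk)
    rw [inner_neg_right] at this ⊢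
    linarith

/-! ### Primitives and their uniform bounds -/

theorem integrableOn_L2 (w : L2) : IntegrableOn w Ω :=
  haveI : IsFiniteMeasure (volume.restrict Ω) := ⟨by simp [Ω]⟩
  (Lp.memLp w).integrable (by norm_num)

theorem intervalIntegrable_L2 (w : L2) : IntervalIntegrable w volume (-1) 1 :=
  (intervalIntegrable_iff_integrableOn_Ioo_of_le (by norm_num)).2 (integrableOn_L2 w)

theorem Ω_subset_uIcc : Ω ⊆ uIcc (-1) 1 := by
  rw [uIcc_of_le (by norm_num)]; exact Ioo_subset_Icc_self

theorem uIcc_subset_uIcc_of_mem_Ω {x : ℝ} (hx : x ∈ Ω) : uIcc (-1) x ⊆ uIcc (-1) 1 :=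
  uIcc_subset_uIcc_left (Ω_subset_uIcc hx)

theorem intervalIntegrable_L2_of_mem (w : L2) {x : ℝ} (hx : x ∈ Ω) :
    IntervalIntegrable w volume (-1) x :=
  (intervalIntegrable_L2 w).mono_set (uIcc_subset_uIcc_of_mem_Ω hx)

theorem continuousOn_σ_one (w : L2) : ContinuousOn (σ 1 w) (uIcc (-1) 1) :=
  intervalIntegral.continuousOn_primitive_interval' (intervalIntegrable_L2 w) left_mem_uIcc

theorem continuousOn_σ_two (w : L2) : ContinuousOn (σ 2 w) (uIcc (-1) 1) :=
  intervalIntegral.continuousOn_primitive_interval' (continuousOn_σ_one w).intervalIntegrable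
    left_mem_uIcc

theorem hasDerivAt_σ_two (w : L2) {x : ℝ} (hx : x ∈ Ω) : HasDerivAt (σ 2 w) (σ 1 w x) x := by
  have hc : ContinuousOn (σ 1 w) Ω := (continuousOn_σ_one w).mono Ω_subset_uIcc
  have ho : IsOpen Ω := isOpen_Ioo
  exact intervalIntegral.integral_hasDerivAt_right
    ((continuousOn_σ_one w).mono (uIcc_subset_uIcc_of_mem_Ω hx)).intervalIntegrable
    (hc.stronglyMeasurableAtFilter ho x hx) (hc.continuousAt (ho.mem_nhds hx))

theorem ae_hasDerivAt_σ_one (w : L2) : ∀ᵐ x, x ∈ Ω → HasDerivAt (σ 1 w) (w x) x := by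
  filter_upwards [(intervalIntegrable_L2 w).ae_hasDerivAt_integral] with x hx hxΩ
  exact hx (Ω_subset_uIcc hxΩ) (-1) left_mem_uIcc

/-- Cauchy–Schwarz against the indicator of `(-1, x]`, whose norm `√(x + 1)` is crudely bounded by
2. -/
theorem abs_σ_one_le (h : L2) {x : ℝ} (hx : x ∈ Ω) : |σ 1 h x| ≤ 2 * ‖h‖ := by
  have hsub : Ioc (-1) x ⊆ Ω := fun t ht => ⟨ht.1, ht.2.trans_lt hx.2⟩
  have hvol : (volume.restrict Ω) (Ioc (-1) x) ≠ ⊤ := by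
    rw [Measure.restrict_apply measurableSet_Ioc, inter_eq_left.2 hsub]; simp
  have hreal : (volume.restrict Ω).real (Ioc (-1) x) = x + 1 := by
    rw [measureReal_restrict_apply measurableSet_Ioc, inter_eq_left.2 hsub,
      Real.volume_real_Ioc_of_le hx.1.le]
    ring
  have heq : σ 1 h x = inner ℝ (indicatorConstLp 2 measurableSet_Ioc hvol (1 : ℝ)) h := by
    rw [L2.inner_indicatorConstLp_one, Measure.restrict_restrict measurableSet_Ioc,
      inter_eq_left.2 hsub]
    exact intervalIntegral.integral_of_le hx.1.le
  have hx1 := hx.1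
  have hx2 := hx.2
  rw [heq]
  refine (abs_real_inner_le_norm _ _).trans (mul_le_mul_of_nonneg_right ?_ (norm_nonneg _))
  refine norm_indicatorConstLp_le.trans ?_
  rw [hreal, norm_one, one_mul]
  calc (x + 1) ^ (1 / (2 : ENNReal).toReal) ≤ 2 ^ (1 / (2 : ENNReal).toReal) :=
        Real.rpow_le_rpow (by linarith) (by linarith) (by positivity)
    _ ≤ 2 ^ (1 : ℝ) := Real.rpow_le_rpow_of_exponent_le (by norm_num) (by norm_num)
    _ = 2 := by simp

theorem integral_deriv_eq_of_tsupport_subset {ψ : ℝ → ℝ} (hψ : ContDiff ℝ ∞ ψ)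
    (hs : tsupport ψ ⊆ Ω) (x : ℝ) : ∫ t in (-1 : ℝ)..x, deriv ψ t = ψ x := by
  rw [intervalIntegral.integral_deriv_eq_sub (fun t _ => hψ.differentiable (by simp) t)
    (hψ.smooth_deriv.continuous.intervalIntegrable _ _),
    image_eq_zero_of_notMem_tsupport (f := ψ) fun h => lt_irrefl _ (hs h).1, sub_zero]

theorem abs_σ_one_sub_le {w k : L2} {ψ : ℝ → ℝ} (hψ : ContDiff ℝ ∞ ψ) (hs : tsupport ψ ⊆ Ω)
    (hk : k =ᵐ[volume.restrict Ω] deriv (deriv ψ)) {x : ℝ} (hx : x ∈ Ω) :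
    |σ 1 w x - deriv ψ x| ≤ 2 * ‖w - k‖ := by
  have h1 := integral_deriv_eq_of_tsupport_subset hψ.smooth_deriv
    (tsupport_deriv_subset.trans hs) x
  have h2 : σ 1 (w - k : L2) x = σ 1 w x - deriv ψ x := by
    rw [← h1]
    change ∫ t in (-1 : ℝ)..x, (w - k : L2) t = (∫ t in (-1 : ℝ)..x, w t) - _
    rw [← intervalIntegral.integral_sub (intervalIntegrable_L2_of_mem w hx)
      (hψ.smooth_deriv.smooth_deriv.continuous.intervalIntegrable _ _)]
    refine intervalIntegral.integral_congr_ae ?_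
    have h3 := (ae_restrict_iff' measurableSet_Ω).1 (Lp.coeFn_sub w k)
    have h4 := (ae_restrict_iff' measurableSet_Ω).1 hk
    filter_upwards [h3, h4] with t h3 h4 ht
    rw [uIoc_of_le hx.1.le] at ht
    have htΩ : t ∈ Ω := ⟨ht.1, ht.2.trans_lt hx.2⟩
    rw [h3 htΩ, Pi.sub_apply, h4 htΩ]
  rw [← h2]
  exact abs_σ_one_le _ hx

/-- Integrates the bound for `σ 1` over an interval of length at most 2, which doubles the constant.
-/
theorem abs_σ_two_sub_le {w k : L2} {ψ : ℝ → ℝ} (hψ : ContDiff ℝ ∞ ψ) (hs : tsupport ψ ⊆ Ω)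
    (hk : k =ᵐ[volume.restrict Ω] deriv (deriv ψ)) {x : ℝ} (hx : x ∈ Ω) :
    |σ 2 w x - ψ x| ≤ 4 * ‖w - k‖ := by
  have h2 : σ 2 w x - ψ x = ∫ t in (-1 : ℝ)..x, (σ 1 w t - deriv ψ t) := by
    rw [intervalIntegral.integral_sub
      ((continuousOn_σ_one w).mono (uIcc_subset_uIcc_of_mem_Ω hx)).intervalIntegrable
      (hψ.smooth_deriv.continuous.intervalIntegrable _ _),
      integral_deriv_eq_of_tsupport_subset hψ hs]
    rfl
  rw [h2, ← Real.norm_eq_abs]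
  refine (intervalIntegral.norm_integral_le_of_norm_le_const (C := 2 * ‖w - k‖)
    fun t ht => ?_).trans ?_
  · rw [uIoc_of_le hx.1.le] at ht
    exact abs_σ_one_sub_le hψ hs hk ⟨ht.1, ht.2.trans_lt hx.2⟩
  · have hx1 := hx.1
    have hx2 := hx.2
    rw [abs_of_pos (by linarith)]
    nlinarith [norm_nonneg (w - k)]

theorem abs_σ_le_of_mem_closure {l₁ l₂ : ℝ} {w : L2} (hw : w ∈ closure (secondDerivs l₁ l₂))
    {x : ℝ} (hx : x ∈ Ω) : |σ 1 w x| ≤ l₁ ∧ |σ 2 w x| ≤ l₂ := by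
  have key : ∀ e > 0, |σ 1 w x| ≤ l₁ + e ∧ |σ 2 w x| ≤ l₂ + e := fun e he => by
    obtain ⟨k, ⟨ψ, hψ, hk⟩, hd⟩ := Metric.mem_closure_iff.1 hw (e / 4) (by positivity)
    rw [dist_eq_norm] at hd
    have h1 := abs_σ_one_sub_le (w := w) hψ.smooth hψ.support hk hx
    have h2 := abs_σ_two_sub_le (w := w) hψ.smooth hψ.support hk hx
    have h3 := hψ.deriv_le x hx
    have h4 := hψ.le x hx
    have h5 := abs_sub_abs_le_abs_sub (σ 1 w x) (deriv ψ x)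
    have h6 := abs_sub_abs_le_abs_sub (σ 2 w x) (ψ x)
    have := norm_nonneg (w - k)
    constructor <;> linarith
  exact ⟨le_of_forall_pos_le_add fun e he => (key e he).1,
    le_of_forall_pos_le_add fun e he => (key e he).2⟩

/-! ### Admissible perturbations -/

theorem _root_.IsCompact.exists_pos_forall_le_sub {C : Set ℝ} (hC : IsCompact C) {f : ℝ → ℝ}
    (hf : ContinuousOn f C) {l : ℝ} (h : ∀ x ∈ C, f x < l) : ∃ δ > 0, ∀ x ∈ C, f x ≤ l - δ := by
  rcases C.eq_empty_or_nonempty with rfl | hne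
  · exact ⟨1, one_pos, by simp⟩
  · obtain ⟨y, hy, hmax⟩ := hC.exists_isMaxOn hne hf
    exact ⟨l - f y, sub_pos.2 (h y hy), fun x hx => by simpa using hmax hx⟩

/-- A perturbation by `t * η` keeps functions close to `f` between `-l` and `l`, if `f` stays away
from the bounds where `η` points outwards. -/
theorem exists_margin {f η : ℝ → ℝ} {l : ℝ} (hf : ContinuousOn f Ω) (hη : Continuous η)
    (hc : HasCompactSupport η) (hs : tsupport η ⊆ Ω)
    (hu : ∀ x ∈ closure {x | 0 < η x}, f x < l) (hl : ∀ x ∈ closure {x | η x < 0}, -l < f x) :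
    ∃ δ > 0, ∀ t, 0 ≤ t → t ≤ δ → ∀ x ∈ Ω, ∀ y, |f x - y| ≤ δ → |y| ≤ l → |y + t * η x| ≤ l := by
  have hup : closure {x | 0 < η x} ⊆ tsupport η := closure_mono fun x hx => ne_of_gt hx
  have hlow : closure {x | η x < 0} ⊆ tsupport η := closure_mono fun x hx => ne_of_lt hx
  obtain ⟨δ₁, hδ₁, h1⟩ := (hc.isCompact.of_isClosed_subset isClosed_closure
    hup).exists_pos_forall_le_sub (hf.mono (hup.trans hs)) hu
  obtain ⟨δ₂, hδ₂, h2⟩ := (hc.isCompact.of_isClosed_subset isClosed_closure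
    hlow).exists_pos_forall_le_sub (hf.mono (hlow.trans hs)).neg
    (l := l) fun x hx => neg_lt.1 (hl x hx)
  obtain ⟨M, hM⟩ := hc.exists_bound_of_continuous hη
  have hM0 : 0 ≤ M := (norm_nonneg _).trans (hM 0)
  -- The margin must absorb both `|f x - y| ≤ δ` and `|t * η x| ≤ δ * M`, hence the factor `M + 1`.
  obtain ⟨δ, hδ, hδ1, hδ2⟩ : ∃ δ > 0, δ * (M + 1) ≤ δ₁ ∧ δ * (M + 1) ≤ δ₂ := by
    refine ⟨min δ₁ δ₂ / (M + 1), by positivity, ?_, ?_⟩ <;> rw [div_mul_cancel₀ _ (by positivity)]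
    exacts [min_le_left _ _, min_le_right _ _]
  refine ⟨δ, hδ, fun t ht htδ x hx y hy hyl => ?_⟩
  have hMx := abs_le.1 (Real.norm_eq_abs _ ▸ hM x)
  rw [abs_le] at hy hyl ⊢
  have hb1 : t * η x ≤ δ * M := by nlinarith
  have hb2 : -(δ * M) ≤ t * η x := by nlinarith
  rcases lt_trichotomy (η x) 0 with h | h | h
  · have : -f x ≤ l - δ₂ := h2 x (subset_closure h)
    have := mul_nonpos_of_nonneg_of_nonpos ht h.le
    constructor <;> linarith
  · rw [h, mul_zero, add_zero]; exact hyl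
  · have := h1 x (subset_closure h)
    have := mul_nonneg ht h.le
    constructor <;> linarith

/-- First order optimality in admissible directions. -/
theorem integral_mul_deriv_deriv_nonneg {l₁ l₂ : ℝ} {u w : L2}
    (hw : w ∈ closure (secondDerivs l₁ l₂))
    (hmin : ∀ k ∈ secondDerivs l₁ l₂, inner ℝ u w ≤ inner ℝ u k) {η : ℝ → ℝ}
    (hη : ContDiff ℝ ∞ η) (hc : HasCompactSupport η) (hs : tsupport η ⊆ Ω)
    (hu₁ : ∀ x ∈ closure {x | 0 < deriv η x}, σ 1 w x < l₁)
    (hl₁ : ∀ x ∈ closure {x | deriv η x < 0}, -l₁ < σ 1 w x)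
    (hu₂ : ∀ x ∈ closure {x | 0 < η x}, σ 2 w x < l₂)
    (hl₂ : ∀ x ∈ closure {x | η x < 0}, -l₂ < σ 2 w x) :
    0 ≤ ∫ x in Ω, u x * deriv (deriv η) x := by
  obtain ⟨h, hh⟩ := exists_L2_ae_eq_deriv_deriv hη hc
  rw [← inner_eq_integral hh]
  obtain ⟨δ₁, hδ₁, h1⟩ := exists_margin ((continuousOn_σ_one w).mono Ω_subset_uIcc)
    hη.smooth_deriv.continuous hc.deriv (tsupport_deriv_subset.trans hs) hu₁ hl₁
  obtain ⟨δ₂, hδ₂, h2⟩ := exists_margin ((continuousOn_σ_two w).mono Ω_subset_uIcc)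
    hη.continuous hc hs hu₂ hl₂
  obtain ⟨t, ht, ht1, ht2⟩ : ∃ t > 0, t ≤ δ₁ ∧ t ≤ δ₂ :=
    ⟨min δ₁ δ₂, by positivity, min_le_left _ _, min_le_right _ _⟩
  obtain ⟨k, hk, hlim⟩ := mem_closure_iff_seq_limit.1 hw
  -- As `w` is only in the closure, the perturbation is applied to its approximants. The tolerance
  -- `t / 4` makes the errors `2‖w - k n‖` and `4‖w - k n‖` at most `t`.
  have hev : ∀ᶠ n in Filter.atTop, inner ℝ u w ≤ inner ℝ u ((1 : ℝ) • k n + t • h) := by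
    filter_upwards [Metric.tendsto_nhds.1 hlim (t / 4) (by positivity)] with n hn
    rw [dist_comm, dist_eq_norm] at hn
    obtain ⟨ψ, hψ, hkψ⟩ := hk n
    refine hmin _ ⟨fun x => 1 * ψ x + t * η x,
      ⟨(contDiff_const.mul hψ.smooth).add (contDiff_const.mul hη),
      hasCompactSupport_lin hψ.compact hc 1 t, tsupport_lin_subset hψ.support hs 1 t,
      fun x hx => ?_, fun x hx => ?_⟩, ?_⟩
    · rw [deriv_lin hψ.smooth hη]
      simp only [one_mul]
      have := norm_nonneg (w - k n)
      exact h1 t ht.le ht1 x hx _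
        ((abs_σ_one_sub_le hψ.smooth hψ.support hkψ hx).trans (by linarith)) (hψ.deriv_le x hx)
    · rw [one_mul]
      exact h2 t ht.le ht2 x hx _
        ((abs_σ_two_sub_le hψ.smooth hψ.support hkψ hx).trans (by linarith)) (hψ.le x hx)
    · rw [deriv_deriv_lin hψ.smooth hη]
      exact lin_ae_eq hkψ hh 1 t
  have hlim' : Filter.Tendsto (fun n => inner ℝ u ((1 : ℝ) • k n + t • h)) Filter.atTop
      (𝓝 (inner ℝ u ((1 : ℝ) • w + t • h))) :=
    tendsto_const_nhds.inner ((hlim.const_smul _).add tendsto_const_nhds)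
  have := ge_of_tendsto hlim' hev
  rw [one_smul, inner_add_right, inner_smul_right] at this
  exact nonneg_of_mul_nonneg_right (by linarith) ht

/-! ### Bump functions and the du Bois-Reymond lemma -/

/-- `η ∈ C_c^∞(U)`. -/
structure IsBumpOn (U : Set ℝ) (η : ℝ → ℝ) : Prop where
  smooth : ContDiff ℝ ∞ η
  compact : HasCompactSupport η
  support : tsupport η ⊆ U

namespace IsBumpOn

variable {U V : Set ℝ} {f g : ℝ → ℝ}

theorem mono (h : IsBumpOn U f) (hUV : U ⊆ V) : IsBumpOn V f :=
  ⟨h.smooth, h.compact, h.support.trans hUV⟩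

theorem deriv (h : IsBumpOn U f) : IsBumpOn U (deriv f) :=
  ⟨h.smooth.smooth_deriv, h.compact.deriv, tsupport_deriv_subset.trans h.support⟩

theorem lin (hf : IsBumpOn U f) (hg : IsBumpOn U g) (a b : ℝ) :
    IsBumpOn U fun x => a * f x + b * g x :=
  ⟨(contDiff_const.mul hf.smooth).add (contDiff_const.mul hg.smooth),
    hasCompactSupport_lin hf.compact hg.compact a b, tsupport_lin_subset hf.support hg.support a b⟩

theorem mul_left (hf : IsBumpOn U f) (hg : ContDiff ℝ ∞ g) : IsBumpOn U fun x => g x * f x :=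
  ⟨hg.mul hf.smooth, hf.compact.mul_left, tsupport_mul_subset_right.trans hf.support⟩

theorem integrableOn_mul (hf : IsBumpOn U f) {u : ℝ → ℝ} (hu : IntegrableOn u Ω) :
    IntegrableOn (fun x => u x * f x) Ω := by
  obtain ⟨M, hM⟩ := hf.compact.exists_bound_of_continuous hf.smooth.continuous
  exact hu.mul_bdd hf.smooth.continuous.aestronglyMeasurable (Filter.Eventually.of_forall hM)

theorem setIntegral_eq (hf : IsBumpOn Ω f) : ∫ x in Ω, f x = ∫ x, f x :=
  setIntegral_eq_integral_of_forall_compl_eq_zero fun _ hx =>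
    image_eq_zero_of_notMem_tsupport fun h => hx (hf.support h)

theorem setIntegral_deriv (hf : IsBumpOn Ω f) : ∫ x in Ω, _root_.deriv f x = 0 := by
  have h := integral_deriv_eq_of_tsupport_subset hf.smooth hf.support 1
  rw [intervalIntegral.integral_of_le (by norm_num), integral_Ioc_eq_integral_Ioo,
    image_eq_zero_of_notMem_tsupport (f := f) fun h => lt_irrefl _ (hf.support h).2] at h
  exact h

theorem setIntegral_id_mul_deriv (hf : IsBumpOn Ω f) :
    ∫ x in Ω, x * _root_.deriv f x = -∫ x in Ω, f x := by
  have h1 := (hf.mul_left contDiff_id).setIntegral_deriv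
  have h2 : _root_.deriv (fun x => id x * f x) = fun x => f x + x * _root_.deriv f x := by
    ext x
    simpa using ((hasDerivAt_id x).fun_mul (hf.smooth.differentiable (by simp) x).hasDerivAt).deriv
  have hi1 : IntegrableOn f Ω :=
    (hf.smooth.continuous.integrable_of_hasCompactSupport hf.compact).integrableOn
  have hi2 : IntegrableOn (fun x => x * _root_.deriv f x) Ω :=
    ((continuous_id.mul hf.deriv.smooth.continuous).integrable_of_hasCompactSupport
      hf.deriv.compact.mul_left).integrableOn
  rw [h2, integral_add hi1 hi2] at h1
  linarith

/-- A bump function with vanishing integral has a primitive supported in the same interval. -/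
theorem exists_primitive {I : Set ℝ} [hI : I.OrdConnected] {ζ : ℝ → ℝ} (h : IsBumpOn I ζ)
    (h0 : ∫ x, ζ x = 0) : ∃ η, IsBumpOn I η ∧ ∀ x, HasDerivAt η (ζ x) x := by
  rcases (tsupport ζ).eq_empty_or_nonempty with he | hne
  · obtain rfl : ζ = 0 := tsupport_eq_empty_iff.1 he
    exact ⟨0, h, fun x => hasDerivAt_const x 0⟩
  have hm := h.compact.isCompact.sInf_mem hne
  have hM := h.compact.isCompact.sSup_mem hne
  set m := sInf (tsupport ζ)
  set M := sSup (tsupport ζ)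
  have hsub : tsupport ζ ⊆ Icc m M := fun x hx =>
    ⟨csInf_le h.compact.isCompact.bddBelow hx, le_csSup h.compact.isCompact.bddAbove hx⟩
  -- Starting at `m - 1` puts all of `[m, M]` inside the half-open interval `(m - 1, x]` once `x >
  -- M`.
  have hd : ∀ x, HasDerivAt (fun x => ∫ t in (m - 1)..x, ζ t) (ζ x) x := fun x =>
    (h.smooth.continuous.integral_hasStrictDerivAt _ _).hasDerivAt
  have hout : ∀ x ∉ Icc m M, ∫ t in (m - 1)..x, ζ t = 0 := fun x hx => by
    rcases lt_or_ge x m with hxm | hxm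
    · refine intervalIntegral.integral_zero_ae (Filter.Eventually.of_forall fun t ht => ?_)
      refine image_eq_zero_of_notMem_tsupport fun hts => ?_
      have := (hsub hts).1
      have := ht.2
      rcases max_cases (m - 1) x with h | h <;> linarith
    · have hxM : M < x := not_le.1 fun hle => hx ⟨hxm, hle⟩
      rw [intervalIntegral.integral_eq_integral_of_support_subset, h0]
      intro t ht
      have := hsub (subset_tsupport _ ht)
      exact ⟨by linarith [this.1], by linarith [this.2]⟩
  refine ⟨fun x => ∫ t in (m - 1)..x, ζ t, ⟨?_, ?_, ?_⟩, hd⟩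
  · refine contDiff_infty_iff_deriv.2 ⟨fun x => (hd x).differentiableAt, ?_⟩
    rw [show _root_.deriv (fun x => ∫ t in (m - 1)..x, ζ t) = ζ from funext fun x => (hd x).deriv]
    exact h.smooth
  · exact HasCompactSupport.intro isCompact_Icc hout
  · refine (closure_minimal (fun x hx => ?_) isClosed_Icc).trans
      (hI.out (h.support hm) (h.support hM))
    by_contra hxI
    exact hx (hout x hxI)

end IsBumpOn

/-- With `ρ` of integral 1, `ζ - (∫ ζ) ρ` has mean zero and is therefore the derivative of a bump
function. A functional that kills derivatives is thus determined by its value at `ρ`. -/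
theorem exists_bump_decomposition {I : Set ℝ} (ho : IsOpen I) [hI : I.OrdConnected]
    (hne : I.Nonempty) (hΩ : I ⊆ Ω) :
    ∃ ρ, IsBumpOn I ρ ∧ ∀ ζ, IsBumpOn I ζ →
      ∃ η, IsBumpOn I η ∧ ζ = fun x => (∫ x in Ω, ζ x) * ρ x + 1 * deriv η x := by
  obtain ⟨a, ha⟩ := hne
  obtain ⟨r, hr, hball⟩ := Metric.nhds_basis_closedBall.mem_iff.1 (ho.mem_nhds ha)
  let f : ContDiffBump a := ⟨r / 2, r, by positivity, by linarith⟩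
  have hρ : IsBumpOn I (f.normed volume) :=
    ⟨f.contDiff_normed, f.hasCompactSupport_normed, by rw [f.tsupport_normed_eq]; exact hball⟩
  refine ⟨_, hρ, fun ζ hζ => ?_⟩
  have hint : ∀ {g : ℝ → ℝ}, IsBumpOn I g → Integrable g := fun hg =>
    hg.smooth.continuous.integrable_of_hasCompactSupport hg.compact
  obtain ⟨η, hη, hd⟩ := (hζ.lin hρ 1 (-∫ x in Ω, ζ x)).exists_primitive (by
    rw [integral_add ((hint hζ).const_mul _) ((hint hρ).const_mul _), integral_const_mul,
      integral_const_mul, f.integral_normed, (hζ.mono hΩ).setIntegral_eq]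
    ring)
  refine ⟨η, hη, funext fun x => ?_⟩
  rw [(hd x).deriv]
  ring

/-- An integrable function with vanishing weak derivative is constant. -/
theorem ae_eq_const_of_integral_mul_deriv_eq_zero {I : Set ℝ} (ho : IsOpen I)
    [hI : I.OrdConnected] (hΩ : I ⊆ Ω) {u : ℝ → ℝ} (hu : IntegrableOn u Ω)
    (h : ∀ η, IsBumpOn I η → ∫ x in Ω, u x * deriv η x = 0) :
    ∃ d, ∀ᵐ x, x ∈ I → u x = d := by
  rcases I.eq_empty_or_nonempty with rfl | hne
  · exact ⟨0, by simp⟩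
  obtain ⟨ρ, hρ, hdec⟩ := exists_bump_decomposition ho hne hΩ
  refine ⟨∫ x in Ω, u x * ρ x, ?_⟩
  have hconst : IntegrableOn (fun _ => ∫ x in Ω, u x * ρ x) Ω :=
    integrableOn_const (by simp [Ω])
  have key := ho.ae_eq_zero_of_integral_contDiff_smul_eq_zero (μ := volume.restrict Ω)
    (f := fun x => u x - ∫ x in Ω, u x * ρ x)
    ((hu.sub hconst).locallyIntegrable.locallyIntegrableOn I) fun ζ h1 h2 h3 => by
      have hζ : IsBumpOn I ζ := ⟨h1, h2, h3⟩
      obtain ⟨η, hη, heq⟩ := hdec ζ hζ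
      have e1 : ∫ x in Ω, u x * ζ x = (∫ x in Ω, ζ x) * ∫ x in Ω, u x * ρ x := by
        conv_lhs => rw [heq]
        simp only [mul_add, one_mul, mul_left_comm (u _)]
        rw [integral_add ((hρ.integrableOn_mul hu).const_mul _) (hη.deriv.integrableOn_mul hu),
          h η hη, add_zero, integral_const_mul]
      simp only [smul_eq_mul, mul_comm (ζ _), sub_mul]
      rw [integral_sub (hζ.integrableOn_mul hu) (hζ.integrableOn_mul hconst), e1,
        integral_const_mul, mul_comm, sub_self]
  filter_upwards [(ae_restrict_iff' measurableSet_Ω).1 key] with x hx hxI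
  exact sub_eq_zero.1 (hx (hΩ hxI) hxI)

/-- An integrable function with vanishing second weak derivative is affine. -/
theorem ae_eq_affine_of_integral_mul_deriv_deriv_eq_zero {I : Set ℝ} (ho : IsOpen I)
    [hI : I.OrdConnected] (hΩ : I ⊆ Ω) {u : ℝ → ℝ} (hu : IntegrableOn u Ω)
    (h : ∀ η, IsBumpOn I η → ∫ x in Ω, u x * deriv (deriv η) x = 0) :
    ∃ c d, ∀ᵐ x, x ∈ I → u x = c * x + d := by
  rcases I.eq_empty_or_nonempty with rfl | hne
  · exact ⟨0, 0, by simp⟩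
  obtain ⟨ρ, hρ, hdec⟩ := exists_bump_decomposition ho hne hΩ
  have hid : IntegrableOn (fun x : ℝ => x) Ω :=
    (continuous_id.integrableOn_Icc (a := -1) (b := 1)).mono_set Ioo_subset_Icc_self
  -- The decomposition gives `∫ u ζ' = c ∫ ζ`: the weak derivative of `u` is `-c`, and `u + c x` has
  -- weak derivative zero.
  set c := ∫ x in Ω, u x * deriv ρ x with hc
  obtain ⟨d, hd⟩ := ae_eq_const_of_integral_mul_deriv_eq_zero ho hΩ (hu.add (hid.const_mul c))
    fun ζ hζ => by
      obtain ⟨η, hη, heq⟩ := hdec ζ hζ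
      have e1 : ∫ x in Ω, u x * deriv ζ x = (∫ x in Ω, ζ x) * c := by
        conv_lhs => rw [heq, deriv_lin hρ.smooth hη.smooth.smooth_deriv]
        simp only [mul_add, one_mul, mul_left_comm (u _)]
        rw [integral_add ((hρ.deriv.integrableOn_mul hu).const_mul _)
          (hη.deriv.deriv.integrableOn_mul hu), h η hη, add_zero, integral_const_mul]
      simp only [Pi.add_apply, add_mul, mul_assoc]
      rw [integral_add (hζ.deriv.integrableOn_mul hu)
        ((hζ.deriv.integrableOn_mul hid).const_mul c), e1, integral_const_mul,
        (hζ.mono hΩ).setIntegral_id_mul_deriv]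
      ring
  refine ⟨-c, d, ?_⟩
  filter_upwards [hd] with x hx hxI
  have : u x + c * x = d := hx hxI
  linarith

/-! ### One-sided optimality and affine pieces -/

/-- The direction `η` may be added to `f` without violating `|f| ≤ l`. -/
def IsAdmissible (l : ℝ) (f η : ℝ → ℝ) : Prop :=
  ∀ x ∈ tsupport η, |f x| < l ∨
    0 < l ∧ ∃ s, |s| = 1 ∧ f x = s * l ∧ ∀ᶠ y in 𝓝 x, s * η y ≤ 0

/-- At upper contact, `η ≤ 0` nearby keeps `x` out of the closure of `{η > 0}`; at lower contact the
claim is `-l < l`, which is where `0 < l` enters. -/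
theorem IsAdmissible.lt_of_mem_closure {l : ℝ} {f η : ℝ → ℝ} (h : IsAdmissible l f η) {x : ℝ}
    (hx : x ∈ closure {x | 0 < η x}) : f x < l := by
  rcases h x (closure_mono (fun y hy => ne_of_gt hy) hx) with h | ⟨hl, s, hs, hfx, hev⟩
  · exact (abs_lt.1 h).2
  · rcases eq_or_eq_neg_of_abs_eq hs with rfl | rfl
    · obtain ⟨y, hy, hy'⟩ := ((mem_closure_iff_frequently.1 hx).and_eventually hev).exists
      have hy : 0 < η y := hy
      linarith
    · linarith

theorem IsAdmissible.neg_lt_of_mem_closure {l : ℝ} {f η : ℝ → ℝ} (h : IsAdmissible l f η) {x : ℝ}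
    (hx : x ∈ closure {x | η x < 0}) : -l < f x := by
  rcases h x (closure_mono (fun y hy => ne_of_lt hy) hx) with h | ⟨hl, s, hs, hfx, hev⟩
  · exact (abs_lt.1 h).1
  · rcases eq_or_eq_neg_of_abs_eq hs with rfl | rfl
    · linarith
    · obtain ⟨y, hy, hy'⟩ := ((mem_closure_iff_frequently.1 hx).and_eventually hev).exists
      have hy : η y < 0 := hy
      linarith

/-- The optimality conditions linking the primal solution `u` and the dual solution `w`. -/
structure IsOptimal (l₁ l₂ : ℝ) (u w : L2) : Prop where
  mem : w ∈ closure (secondDerivs l₁ l₂)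
  le : ∀ k ∈ secondDerivs l₁ l₂, inner ℝ u w ≤ inner ℝ u k

section

variable {l₁ l₂ : ℝ} {u w : L2}

theorem IsOptimal.integral_nonneg (h : IsOptimal l₁ l₂ u w) {η : ℝ → ℝ} (hη : IsBumpOn Ω η)
    (h₁ : IsAdmissible l₁ (σ 1 w) (deriv η)) (h₂ : IsAdmissible l₂ (σ 2 w) η) :
    0 ≤ ∫ x in Ω, u x * deriv (deriv η) x :=
  integral_mul_deriv_deriv_nonneg h.mem h.le hη.smooth hη.compact hη.support
    (fun _ => h₁.lt_of_mem_closure) (fun _ => h₁.neg_lt_of_mem_closure)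
    (fun _ => h₂.lt_of_mem_closure) (fun _ => h₂.neg_lt_of_mem_closure)

/-- Without contact on the supports, `η` and `-η` are both admissible. -/
theorem IsOptimal.integral_eq_zero (h : IsOptimal l₁ l₂ u w) {η : ℝ → ℝ} (hη : IsBumpOn Ω η)
    (h₁ : ∀ x ∈ tsupport (deriv η), |σ 1 w x| < l₁) (h₂ : ∀ x ∈ tsupport η, |σ 2 w x| < l₂) :
    ∫ x in Ω, u x * deriv (deriv η) x = 0 := by
  refine le_antisymm ?_ (h.integral_nonneg hη (fun x hx => .inl (h₁ x hx))
    fun x hx => .inl (h₂ x hx))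
  have hneg := h.integral_nonneg (hη.lin hη (-1) 0) (fun x hx => .inl (h₁ x ?_))
    fun x hx => .inl (h₂ x (tsupport_lin_subset le_rfl le_rfl _ _ hx))
  · rw [deriv_deriv_lin hη.smooth hη.smooth] at hneg
    simp only [zero_mul, add_zero, neg_mul, one_mul, mul_neg, integral_neg] at hneg
    linarith
  · rw [deriv_lin hη.smooth hη.smooth] at hx
    exact tsupport_lin_subset le_rfl le_rfl _ _ hx

theorem IsOptimal.exists_affine (h : IsOptimal l₁ l₂ u w) {I : Set ℝ} (ho : IsOpen I)
    (hI : I.OrdConnected) (hΩ : I ⊆ Ω) (h₁ : ∀ x ∈ I, |σ 1 w x| < l₁)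
    (h₂ : ∀ x ∈ I, |σ 2 w x| < l₂) : ∃ c d, ∀ᵐ x : ℝ, x ∈ I → u x = c * x + d :=
  ae_eq_affine_of_integral_mul_deriv_deriv_eq_zero ho hΩ (integrableOn_L2 u) fun _ hη =>
    h.integral_eq_zero (hη.mono hΩ) (fun x hx => h₁ x (hη.deriv.support hx))
      fun x hx => h₂ x (hη.support hx)

theorem IsOptimal.exists_eqTwoAffine (h : IsOptimal l₁ l₂ u w) {J : Set ℝ} (ho : IsOpen J)
    (hJ : J.OrdConnected) (hΩ : J ⊆ Ω) {x₀ : ℝ} (h₁ : ∀ x ∈ J, x ≠ x₀ → |σ 1 w x| < l₁)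
    (h₂ : ∀ x ∈ J, x ≠ x₀ → |σ 2 w x| < l₂) : ∃ c₁ d₁ c₂ d₂, EqTwoAffine u J x₀ c₁ d₁ c₂ d₂ := by
  obtain ⟨c₁, d₁, hl⟩ := h.exists_affine (ho.inter isOpen_Iio) (hJ.inter ordConnected_Iio)
    (inter_subset_left.trans hΩ) (fun x (hx : x ∈ J ∩ Iio x₀) => h₁ x hx.1 (ne_of_lt hx.2))
    fun x hx => h₂ x hx.1 (ne_of_lt hx.2)
  obtain ⟨c₂, d₂, hr⟩ := h.exists_affine (ho.inter isOpen_Ioi) (hJ.inter ordConnected_Ioi)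
    (inter_subset_left.trans hΩ) (fun x (hx : x ∈ J ∩ Ioi x₀) => h₁ x hx.1 (ne_of_gt hx.2))
    fun x hx => h₂ x hx.1 (ne_of_gt hx.2)
  refine ⟨c₁, d₁, c₂, d₂, ?_, ?_⟩
  · filter_upwards [hl] with x hx hxJ hlt using hx ⟨hxJ, hlt⟩
  · filter_upwards [hr] with x hx hxJ hlt using hx ⟨hxJ, hlt⟩

end

/-! ### Integration by parts and the choice of germs -/

theorem hasDerivAt_affine_mul_deriv_sub {η : ℝ → ℝ} (hη : ContDiff ℝ ∞ η) (c d x : ℝ) :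
    HasDerivAt (fun x => (c * x + d) * deriv η x - c * η x) ((c * x + d) * deriv (deriv η) x) x := by
  have h1 : HasDerivAt (fun x => c * x + d) c x := by
    simpa using ((hasDerivAt_id x).const_mul c).add_const d
  have h2 := (hη.smooth_deriv.differentiable (by simp) x).hasDerivAt
  have h3 := (hη.differentiable (by simp) x).hasDerivAt
  exact ((h1.fun_mul h2).fun_sub (h3.const_mul c)).congr_deriv (by ring)

/-- Integration by parts against a function with two affine pieces. -/
theorem EqTwoAffine.integral_mul_deriv_deriv {u : ℝ → ℝ} {J : Set ℝ} {x₀ c₁ d₁ c₂ d₂ : ℝ}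
    (h : EqTwoAffine u J x₀ c₁ d₁ c₂ d₂) (hu : IntegrableOn u Ω) (hx₀ : x₀ ∈ Ω) (hΩ : J ⊆ Ω)
    {η : ℝ → ℝ} (hη : IsBumpOn J η) :
    ∫ x in Ω, u x * deriv (deriv η) x =
      (c₂ - c₁) * η x₀ - ((c₂ * x₀ + d₂) - (c₁ * x₀ + d₁)) * deriv η x₀ := by
  have hηΩ := hη.mono hΩ
  have hint : IntervalIntegrable (fun x => u x * deriv (deriv η) x) volume (-1) 1 :=
    (intervalIntegrable_iff_integrableOn_Ioo_of_le (by norm_num)).2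
      (hηΩ.deriv.deriv.integrableOn_mul hu)
  have hmem := Ω_subset_uIcc hx₀
  have hout : ∀ x ∉ Ω, η x = 0 ∧ deriv η x = 0 := fun x hx =>
    ⟨image_eq_zero_of_notMem_tsupport fun h => hx (hηΩ.support h),
      image_eq_zero_of_notMem_tsupport fun h => hx (hηΩ.deriv.support h)⟩
  obtain ⟨m1, m2⟩ := hout (-1) fun h => lt_irrefl _ h.1
  obtain ⟨p1, p2⟩ := hout 1 fun h => lt_irrefl _ h.2
  have hcont : ∀ c d : ℝ, Continuous fun x => (c * x + d) * deriv (deriv η) x := fun c d =>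
    (by fun_prop : Continuous fun x => c * x + d).mul hη.deriv.deriv.smooth.continuous
  have piece : ∀ c d a b : ℝ,
      (∀ᵐ x : ℝ, x ∈ uIoc a b → x ∈ J → u x = c * x + d) →
      ∫ x in a..b, u x * deriv (deriv η) x =
        ((c * b + d) * deriv η b - c * η b) - ((c * a + d) * deriv η a - c * η a) := by
    intro c d a b hae
    rw [← intervalIntegral.integral_eq_sub_of_hasDerivAt
      (fun x _ => hasDerivAt_affine_mul_deriv_sub hη.smooth c d x)
      ((hcont c d).intervalIntegrable _ _)]
    refine intervalIntegral.integral_congr_ae ?_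
    filter_upwards [hae] with x hx hxab
    by_cases hxJ : x ∈ J
    · rw [hx hxab hxJ]
    · rw [image_eq_zero_of_notMem_tsupport (f := deriv (deriv η))
        fun h => hxJ (hη.deriv.deriv.support h), mul_zero, mul_zero]
  have hsplit := intervalIntegral.integral_add_adjacent_intervals
    (hint.mono_set (uIcc_subset_uIcc_left hmem)) (hint.mono_set (uIcc_subset_uIcc_right hmem))
  have hne : ∀ᵐ x : ℝ, x ≠ x₀ := by simp [ae_iff]
  have hfull : ∫ x in Ω, u x * deriv (deriv η) x =
      ∫ x in (-1 : ℝ)..1, u x * deriv (deriv η) x := by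
    rw [intervalIntegral.integral_of_le (by norm_num), integral_Ioc_eq_integral_Ioo]
    rfl
  rw [hfull, ← hsplit, piece c₁ d₁ (-1) x₀, piece c₂ d₂ x₀ 1, m1, m2, p1, p2]
  · ring
  · filter_upwards [h.2] with x hx hxI hxJ
    rw [uIoc_of_le hx₀.2.le] at hxI
    exact hx hxJ hxI.1
  · filter_upwards [h.1, hne] with x hx hxne hxI hxJ
    rw [uIoc_of_le hx₀.1.le] at hxI
    exact hx hxJ (lt_of_le_of_ne hxI.2 hxne)

theorem exists_cutoff {J : Set ℝ} {x₀ : ℝ} (hJ : J ∈ 𝓝 x₀) :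
    ∃ f, IsBumpOn J f ∧ (∀ x, 0 ≤ f x) ∧ ∀ᶠ x in 𝓝 x₀, f x = 1 := by
  obtain ⟨r, hr, hball⟩ := Metric.nhds_basis_closedBall.mem_iff.1 hJ
  let f : ContDiffBump x₀ := ⟨r / 2, r, by positivity, by linarith⟩
  exact ⟨f, ⟨f.contDiff, f.hasCompactSupport, by rw [f.tsupport_eq]; exact hball⟩,
    fun x => f.nonneg, f.eventuallyEq_one⟩

/-- A smooth germ at `x₀` extends to a bump function. -/
theorem exists_bump_germ {J : Set ℝ} {x₀ : ℝ} (hJ : J ∈ 𝓝 x₀) {g : ℝ → ℝ} (hg : ContDiff ℝ ∞ g) :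
    ∃ η, IsBumpOn J η ∧ (∀ x, ∃ a ≥ 0, η x = g x * a) ∧ (∀ᶠ x in 𝓝 x₀, η x = g x) ∧
      ∀ᶠ x in 𝓝 x₀, deriv η x = deriv g x := by
  obtain ⟨f, hf, hf0, hf1⟩ := exists_cutoff hJ
  have heq : (fun x => g x * f x) =ᶠ[𝓝 x₀] g := by
    filter_upwards [hf1] with x hx
    rw [hx, mul_one]
  exact ⟨_, hf.mul_left hg, fun x => ⟨f x, hf0 x, rfl⟩, heq, heq.deriv⟩

section

variable {l₁ l₂ : ℝ} {u w : L2} {J : Set ℝ} {x₀ c₁ d₁ c₂ d₂ s : ℝ}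

/-- The germ `1` has `η' = 0` near `x₀`, so it avoids the contact and gives equality, hence equal
slopes. The germ `-s (x - x₀)` has `η x₀ = 0` and `η'` pointing inwards, which leaves the sign of
the jump. -/
theorem IsOptimal.jump (h : IsOptimal l₁ l₂ u w) (hJ : J ∈ 𝓝 x₀) (hΩ : J ⊆ Ω) (hl : 0 < l₁)
    (h₁ : ∀ x ∈ J, x ≠ x₀ → |σ 1 w x| < l₁) (h₂ : ∀ x ∈ J, |σ 2 w x| < l₂) (hs : |s| = 1)
    (hx₀ : σ 1 w x₀ = s * l₁) (hu : EqTwoAffine u J x₀ c₁ d₁ c₂ d₂) :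
    c₂ = c₁ ∧ 0 ≤ s * (d₂ - d₁) := by
  have hx₀Ω := hΩ (mem_of_mem_nhds hJ)
  have hint := integrableOn_L2 u
  have hc : c₂ = c₁ := by
    obtain ⟨η, hη, -, hv, hd⟩ := exists_bump_germ hJ (g := fun _ => 1) contDiff_const
    have h0 : deriv η =ᶠ[𝓝 x₀] 0 := by
      filter_upwards [hd] with x hx
      simpa using hx
    have := h.integral_eq_zero (hη.mono hΩ) (fun x hx => h₁ x (hη.deriv.support hx) ?_)
      fun x hx => h₂ x (hη.support hx)
    · rw [hu.integral_mul_deriv_deriv hint hx₀Ω hΩ hη, hv.self_of_nhds, h0.self_of_nhds,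
        Pi.zero_apply] at this
      linarith
    · rintro rfl
      exact notMem_tsupport_iff_eventuallyEq.2 h0 hx
  refine ⟨hc, ?_⟩
  obtain ⟨η, hη, -, hv, hd⟩ := exists_bump_germ hJ (g := fun x => -s * (x - x₀)) (by fun_prop)
  have hderiv : ∀ x, deriv (fun x => -s * (x - x₀)) x = -s := fun x => by
    simp
  simp only [hderiv] at hd
  have hss : s * s = 1 := by rw [← abs_mul_abs_self, hs, one_mul]
  have := h.integral_nonneg (hη.mono hΩ) (fun x hx => ?_)
    fun x hx => .inl (h₂ x (hη.support hx))
  · rw [hu.integral_mul_deriv_deriv hint hx₀Ω hΩ hη, hv.self_of_nhds, hd.self_of_nhds, hc] at this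
    linarith
  · by_cases hxx : x = x₀
    · subst hxx
      refine .inr ⟨hl, s, hs, hx₀, ?_⟩
      filter_upwards [hd] with y hy
      rw [hy]
      linarith
    · exact .inl (h₁ x (hη.deriv.support hx) hxx)

/-- Only the sign of `η` is constrained; `η' x₀ = -s k` is arbitrary. An inequality affine in `k`
and valid for all real `k` has zero coefficient, so there is no jump, and `k = 0` gives the sign of
the bend. -/
theorem IsOptimal.bending (h : IsOptimal l₁ l₂ u w) (hJ : J ∈ 𝓝 x₀) (hΩ : J ⊆ Ω) (hl : 0 < l₂)
    (h₁ : ∀ x ∈ J, |σ 1 w x| < l₁) (h₂ : ∀ x ∈ J, x ≠ x₀ → |σ 2 w x| < l₂) (hs : |s| = 1)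
    (hx₀ : σ 2 w x₀ = s * l₂) (hu : EqTwoAffine u J x₀ c₁ d₁ c₂ d₂) :
    c₁ * x₀ + d₁ = c₂ * x₀ + d₂ ∧ s * (c₂ - c₁) ≤ 0 := by
  have hx₀Ω := hΩ (mem_of_mem_nhds hJ)
  have hint := integrableOn_L2 u
  have hss : s * s = 1 := by rw [← abs_mul_abs_self, hs, one_mul]
  have key : ∀ k : ℝ,
      0 ≤ -(s * (c₂ - c₁)) + k * (s * ((c₂ * x₀ + d₂) - (c₁ * x₀ + d₁))) := fun k => by
    -- The polynomial `1 + q + q²` with `q = k (x - x₀)` is positive for all `q`, with value 1 and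
    -- slope `k` at `x₀`.
    obtain ⟨η, hη, hpos, hv, hd⟩ := exists_bump_germ hJ
      (g := fun x => -s * (1 + k * (x - x₀) + (k * (x - x₀)) ^ 2)) (by fun_prop)
    have hderiv : deriv (fun x => -s * (1 + k * (x - x₀) + (k * (x - x₀)) ^ 2)) x₀ = -s * k := by
      have h1 := ((hasDerivAt_id x₀).sub_const x₀).const_mul k
      simpa using (((h1.const_add 1).fun_add (h1.fun_pow 2)).const_mul (-s)).deriv
    have := h.integral_nonneg (hη.mono hΩ) (fun x hx => .inl (h₁ x (hη.deriv.support hx)))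
      fun x hx => ?_
    · rw [hu.integral_mul_deriv_deriv hint hx₀Ω hΩ hη, hv.self_of_nhds, hd.self_of_nhds,
        hderiv] at this
      simp only [sub_self, mul_zero] at this
      linarith
    · by_cases hxx : x = x₀
      · subst hxx
        refine .inr ⟨hl, s, hs, hx₀, Filter.Eventually.of_forall fun y => ?_⟩
        obtain ⟨a, ha, hy⟩ := hpos y
        have hq : 0 ≤ 1 + k * (y - x) + (k * (y - x)) ^ 2 := by
          nlinarith [sq_nonneg (1 + k * (y - x)), sq_nonneg (k * (y - x))]
        rw [hy]
        have := mul_nonneg hq ha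
        rw [← mul_assoc, ← mul_assoc, mul_neg, hss]
        linarith
      · exact .inl (h₂ x (hη.support hx) hxx)
  set j := s * ((c₂ * x₀ + d₂) - (c₁ * x₀ + d₁)) with hj
  have hj0 : j = 0 := by
    by_contra hne
    -- This `k` turns the right-hand side of `key` into `-1`.
    have := key ((s * (c₂ - c₁) - 1) / j)
    rw [div_mul_cancel₀ _ hne] at this
    linarith
  refine ⟨?_, by simpa [hj0] using key 0⟩
  have : s * j = (c₂ * x₀ + d₂) - (c₁ * x₀ + d₁) := by rw [hj, ← mul_assoc, hss, one_mul]
  rw [hj0, mul_zero] at this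
  linarith

end

/-! ### Saturated intervals -/

theorem _root_.HasDerivAt.eq_zero_of_abs_eq {f : ℝ → ℝ} {f' x l : ℝ} (hf : HasDerivAt f f' x)
    (hx : |f x| = l) (h : ∀ᶠ y in 𝓝 x, |f y| ≤ l) : f' = 0 := by
  rcases abs_choice (f x) with he | he
  · refine IsLocalMax.hasDerivAt_eq_zero (f := f) (a := x) ?_ hf
    filter_upwards [h] with y hy
    linarith [le_abs_self (f y)]
  · refine IsLocalMin.hasDerivAt_eq_zero (f := f) (a := x) ?_ hf
    filter_upwards [h] with y hy
    linarith [neg_abs_le (f y)]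

/-- The frontier of a convex set is null. -/
theorem ae_mem_interior_of_ordConnected {A : Set ℝ} (hA : A.OrdConnected) :
    ∀ᵐ x : ℝ, x ∈ A → x ∈ interior A := by
  filter_upwards [compl_mem_ae_iff.2 (hA.convex.addHaar_frontier volume)] with x hx hxA
  by_contra hxi
  exact hx ⟨subset_closure hxA, hxi⟩

/-- The dual solution vanishes where one of the constraints is active on an interval. -/
theorem ae_eq_zero_of_saturated (w : L2) {l₁ l₂ : ℝ} {A : Set ℝ} (hA : A.OrdConnected)
    (hΩ : A ⊆ Ω) (h : (∀ x ∈ A, |σ 1 w x| = l₁) ∨ ∀ x ∈ A, |σ 2 w x| = l₂) :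
    ∀ᵐ x : ℝ, x ∈ A → w x = 0 := by
  -- Saturation of `σ 2` forces its derivative `σ 1` to vanish, so in both cases `|σ 1|` is constant
  -- on the interior.
  obtain ⟨l, hl⟩ : ∃ l, ∀ x ∈ interior A, |σ 1 w x| = l := by
    rcases h with h | h
    · exact ⟨l₁, fun x hx => h x (interior_subset hx)⟩
    · refine ⟨0, fun x hx => abs_eq_zero.2 ?_⟩
      refine (hasDerivAt_σ_two w (hΩ (interior_subset hx))).eq_zero_of_abs_eq
        (h x (interior_subset hx)) ?_
      filter_upwards [mem_interior_iff_mem_nhds.1 hx] with y hy using (h y hy).le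
  filter_upwards [ae_mem_interior_of_ordConnected hA, ae_hasDerivAt_σ_one w] with x hx hd hxA
  refine (hd (hΩ hxA)).eq_zero_of_abs_eq (hl x (hx hxA)) ?_
  filter_upwards [isOpen_interior.mem_nhds (hx hxA)] with y hy using (hl y hy).le

/-! ### Components around isolated contact points -/

section

variable {f : ℝ → ℝ} {l x₀ ε : ℝ}

theorem comp_subset : comp f l x₀ ε ⊆ {x | x ∈ Ioo (x₀ - ε) (x₀ + ε) ∩ Ω ∧ |f x| < l} :=
  connectedComponentIn_subset _ _

theorem ordConnected_comp : (comp f l x₀ ε).OrdConnected :=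
  isPreconnected_connectedComponentIn.ordConnected

theorem isOpen_comp (hf : ContinuousOn f Ω) : IsOpen (comp f l x₀ ε) := by
  refine IsOpen.connectedComponentIn ?_
  exact (hf.abs.mono inter_subset_right).isOpen_inter_preimage (isOpen_Ioo.inter isOpen_Ioo)
    isOpen_Iio

theorem comp_mem_nhds (hf : ContinuousOn f Ω) (hx₀ : x₀ ∈ Ω) (hε : 0 < ε) (h : |f x₀| < l) :
    comp f l x₀ ε ∈ 𝓝 x₀ :=
  (isOpen_comp hf).mem_nhds
    (mem_connectedComponentIn ⟨⟨⟨by linarith, by linarith⟩, hx₀⟩, h⟩)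

theorem pos_of_abs_lt_near (hx₀ : x₀ ∈ Ω) (hε : 0 < ε)
    (h : ∀ x ∈ Ioo (x₀ - ε) (x₀ + ε) ∩ Ω, x ≠ x₀ → |f x| < l) : 0 < l := by
  have hmem : Ioo (x₀ - ε) (x₀ + ε) ∩ Ω ∈ 𝓝 x₀ :=
    Filter.inter_mem (Ioo_mem_nhds (by linarith) (by linarith)) (Ioo_mem_nhds hx₀.1 hx₀.2)
  obtain ⟨x, hx, hne⟩ :=
    ((eventually_nhdsWithin_of_eventually_nhds hmem).and self_mem_nhdsWithin :
      ∀ᶠ x in 𝓝[≠] x₀, x ∈ Ioo (x₀ - ε) (x₀ + ε) ∩ Ω ∧ x ∈ ({x₀}ᶜ : Set ℝ)).exists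
  exact (abs_nonneg _).trans_lt (h x hx hne)

end

section

variable {l₁ l₂ x₀ ε s : ℝ} {u w : L2}

theorem IsOptimal.eventually_abs_σ_two_le (h : IsOptimal l₁ l₂ u w) (hx₀ : x₀ ∈ Ω) :
    ∀ᶠ y in 𝓝 x₀, |σ 2 w y| ≤ l₂ := by
  filter_upwards [Ioo_mem_nhds hx₀.1 hx₀.2] with y hy
  exact (abs_σ_le_of_mem_closure h.mem hy).2

/-- If `σ 2` were also in contact at `x₀`, its derivative `σ 1 w x₀ = s * l₁` would vanish,
contradicting `0 < l₁`. So `σ 2` is strictly inside its bounds at `x₀`, and `jump` applies on the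
component. -/
theorem IsOptimal.jump_condition (h : IsOptimal l₁ l₂ u w) (hx₀ : x₀ ∈ Ω) (hε : 0 < ε)
    (h₁ : ∀ x ∈ Ioo (x₀ - ε) (x₀ + ε) ∩ Ω, x ≠ x₀ → |σ 1 w x| < l₁) (hs : |s| = 1)
    (hσ : σ 1 w x₀ = s * l₁) :
    comp (σ 2 w) l₂ x₀ ε ∈ 𝓝 x₀ ∧ ∃ c₁ d₁ d₂ : ℝ, 0 ≤ s * (d₂ - d₁) ∧
      EqTwoAffine u (comp (σ 2 w) l₂ x₀ ε) x₀ c₁ d₁ c₁ d₂ := by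
  have hl := pos_of_abs_lt_near hx₀ hε h₁
  have hcont := (continuousOn_σ_two w).mono Ω_subset_uIcc
  have hlt : |σ 2 w x₀| < l₂ := by
    refine lt_of_le_of_ne (abs_σ_le_of_mem_closure h.mem hx₀).2 fun heq => ?_
    have h0 := (hasDerivAt_σ_two w hx₀).eq_zero_of_abs_eq heq (h.eventually_abs_σ_two_le hx₀)
    rw [hσ] at h0
    have h1 : |s * l₁| = l₁ := by rw [abs_mul, hs, one_mul, abs_of_pos hl]
    rw [h0, abs_zero] at h1
    exact hl.ne h1
  have hJ := comp_mem_nhds hcont hx₀ hε hlt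
  have hΩ : comp (σ 2 w) l₂ x₀ ε ⊆ Ω := fun x hx => (comp_subset hx).1.2
  have hJ₁ : ∀ x ∈ comp (σ 2 w) l₂ x₀ ε, x ≠ x₀ → |σ 1 w x| < l₁ :=
    fun x hx => h₁ x (comp_subset hx).1
  have hJ₂ : ∀ x ∈ comp (σ 2 w) l₂ x₀ ε, |σ 2 w x| < l₂ := fun x hx => (comp_subset hx).2
  obtain ⟨c₁, d₁, c₂, d₂, hu⟩ := h.exists_eqTwoAffine (isOpen_comp hcont) ordConnected_comp hΩ
    hJ₁ fun x hx _ => hJ₂ x hx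
  obtain ⟨rfl, hsign⟩ := h.jump hJ hΩ hl hJ₁ hJ₂ hs hσ hu
  exact ⟨hJ, _, _, _, hsign, hu⟩

theorem IsOptimal.bending_condition (h : IsOptimal l₁ l₂ u w) (hx₀ : x₀ ∈ Ω) (hε : 0 < ε)
    (h₂ : ∀ x ∈ Ioo (x₀ - ε) (x₀ + ε) ∩ Ω, x ≠ x₀ → |σ 2 w x| < l₂) (hs : |s| = 1)
    (hσ : σ 2 w x₀ = s * l₂) :
    comp (σ 1 w) l₁ x₀ ε ∈ 𝓝 x₀ ∧ ∃ c₁ d₁ c₂ d₂ : ℝ, s * (c₂ - c₁) ≤ 0 ∧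
      c₁ * x₀ + d₁ = c₂ * x₀ + d₂ ∧
      EqTwoAffine u (comp (σ 1 w) l₁ x₀ ε) x₀ c₁ d₁ c₂ d₂ := by
  have hl := pos_of_abs_lt_near hx₀ hε h₂
  have hcont := (continuousOn_σ_one w).mono Ω_subset_uIcc
  have habs : |σ 2 w x₀| = l₂ := by rw [hσ, abs_mul, hs, one_mul, abs_of_pos hl]
  have hlt : |σ 1 w x₀| < l₁ := by
    have h0 := (hasDerivAt_σ_two w hx₀).eq_zero_of_abs_eq habs (h.eventually_abs_σ_two_le hx₀)
    -- Contact of `σ 1` would give `l₁ = 0`, hence `σ 1 = 0` throughout `Ω` and `σ 2 w x₀ = 0`,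
    -- contradicting `0 < l₂`.
    refine lt_of_le_of_ne (abs_σ_le_of_mem_closure h.mem hx₀).1 fun heq => hl.ne ?_
    rw [h0, abs_zero] at heq
    have : σ 2 w x₀ = 0 := by
      refine intervalIntegral.integral_zero_ae (Filter.Eventually.of_forall fun t ht => ?_)
      rw [uIoc_of_le hx₀.1.le] at ht
      have := (abs_σ_le_of_mem_closure h.mem (x := t) ⟨ht.1, ht.2.trans_lt hx₀.2⟩).1
      exact abs_nonpos_iff.1 (heq ▸ this)
    rw [← habs, this, abs_zero]
  have hJ := comp_mem_nhds hcont hx₀ hε hlt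
  have hΩ : comp (σ 1 w) l₁ x₀ ε ⊆ Ω := fun x hx => (comp_subset hx).1.2
  have hJ₁ : ∀ x ∈ comp (σ 1 w) l₁ x₀ ε, |σ 1 w x| < l₁ := fun x hx => (comp_subset hx).2
  have hJ₂ : ∀ x ∈ comp (σ 1 w) l₁ x₀ ε, x ≠ x₀ → |σ 2 w x| < l₂ :=
    fun x hx => h₂ x (comp_subset hx).1
  obtain ⟨c₁, d₁, c₂, d₂, hu⟩ := h.exists_eqTwoAffine (isOpen_comp hcont) ordConnected_comp hΩ
    (fun x hx _ => hJ₁ x hx) hJ₂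
  obtain ⟨heq, hsign⟩ := h.bending hJ hΩ hl hJ₁ hJ₂ hs hσ hu
  exact ⟨hJ, c₁, d₁, c₂, d₂, hsign, heq, hu⟩

theorem IsOptimal.exists_polynomial (h : IsOptimal l₁ l₂ u w) {B : Set ℝ}
    (hB : B = {x | x ∈ Ω ∧ |σ 1 w x| < l₁ ∧ |σ 2 w x| < l₂}) (x₀ : ℝ) :
    ∃ p : Polynomial ℝ, p.degree ≤ 1 ∧
      ∀ᵐ x : ℝ, x ∈ connectedComponentIn B x₀ → u x = p.eval x := by
  have hopen : IsOpen B := by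
    have h1 := ((continuousOn_σ_one w).mono Ω_subset_uIcc).abs.isOpen_inter_preimage
      isOpen_Ioo (isOpen_Iio (a := l₁))
    have h2 := ((continuousOn_σ_two w).mono Ω_subset_uIcc).abs.isOpen_inter_preimage
      isOpen_Ioo (isOpen_Iio (a := l₂))
    convert h1.inter h2 using 1
    rw [hB]
    ext x
    exact ⟨fun hx => ⟨⟨hx.1, hx.2.1⟩, hx.1, hx.2.2⟩, fun hx => ⟨hx.1.1, hx.1.2, hx.2.2⟩⟩
  have hsub : connectedComponentIn B x₀ ⊆ {x | x ∈ Ω ∧ |σ 1 w x| < l₁ ∧ |σ 2 w x| < l₂} :=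
    hB ▸ connectedComponentIn_subset B x₀
  obtain ⟨c, d, hcd⟩ := h.exists_affine hopen.connectedComponentIn
    isPreconnected_connectedComponentIn.ordConnected (fun x hx => (hsub hx).1)
    (fun x hx => (hsub hx).2.1) fun x hx => (hsub hx).2.2
  refine ⟨Polynomial.C c * Polynomial.X + Polynomial.C d, Polynomial.degree_linear_le, ?_⟩
  filter_upwards [hcd] with x hx hxB
  simpa using hx hxB

end

end TGV1D

/-! ### Structure of the minimizers -/

open TGV1D in
theorem mainTheorem4 (l₁ l₂ : ℝ) (hl₁ : 0 ≤ l₁) (hl₂ : 0 ≤ l₂) (uδ u ustar : L2)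
    -- `u` minimizes the primal functional, `ustar` the dual functional
    (hu : IsMinOn (primal l₁ l₂ uδ) Set.univ u)
    (hustar : IsMinOn (dual l₁ l₂ uδ) Set.univ ustar) :
    ustar = u - uδ ∧
    -- affine on each connected component of `B`
    (∀ B : Set ℝ, B = {x | x ∈ Ω ∧ |σ 1 ustar x| < l₁ ∧ |σ 2 ustar x| < l₂} →
      ∀ x₀ ∈ B, ∃ p : Polynomial ℝ, p.degree ≤ 1 ∧
        ∀ᵐ x : ℝ, x ∈ connectedComponentIn B x₀ → u x = p.eval x) ∧
    -- equality with the data on intervals of saturation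
    (∀ A : Set ℝ, A.OrdConnected → A ⊆ Ω →
      ((∀ x ∈ A, |σ 1 ustar x| = l₁) ∨ (∀ x ∈ A, |σ 2 ustar x| = l₂)) →
      ∀ᵐ x : ℝ, x ∈ A → u x = uδ x) ∧
    -- jump condition
    (∀ x₀ ∈ Ω, ∀ ε > 0,
      (∀ x ∈ Set.Ioo (x₀ - ε) (x₀ + ε) ∩ Ω, x ≠ x₀ → |σ 1 ustar x| < l₁) →
      (σ 1 ustar x₀ = l₁ →
        comp (σ 2 ustar) l₂ x₀ ε ∈ nhds x₀ ∧
        ∃ c₁ d₁ d₂ : ℝ, d₁ ≤ d₂ ∧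
          EqTwoAffine u (comp (σ 2 ustar) l₂ x₀ ε) x₀ c₁ d₁ c₁ d₂) ∧
      (σ 1 ustar x₀ = -l₁ →
        comp (σ 2 ustar) l₂ x₀ ε ∈ nhds x₀ ∧
        ∃ c₁ d₁ d₂ : ℝ, d₂ ≤ d₁ ∧
          EqTwoAffine u (comp (σ 2 ustar) l₂ x₀ ε) x₀ c₁ d₁ c₁ d₂)) ∧
    -- bending condition; the equation between the two values at `x₀` is continuity at `x₀`
    (∀ x₀ ∈ Ω, ∀ ε > 0,
      (∀ x ∈ Set.Ioo (x₀ - ε) (x₀ + ε) ∩ Ω, x ≠ x₀ → |σ 2 ustar x| < l₂) →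
      (σ 2 ustar x₀ = l₂ →
        comp (σ 1 ustar) l₁ x₀ ε ∈ nhds x₀ ∧
        ∃ c₁ d₁ c₂ d₂ : ℝ, c₂ ≤ c₁ ∧ c₁ * x₀ + d₁ = c₂ * x₀ + d₂ ∧
          EqTwoAffine u (comp (σ 1 ustar) l₁ x₀ ε) x₀ c₁ d₁ c₂ d₂) ∧
      (σ 2 ustar x₀ = -l₂ →
        comp (σ 1 ustar) l₁ x₀ ε ∈ nhds x₀ ∧
        ∃ c₁ d₁ c₂ d₂ : ℝ, c₁ ≤ c₂ ∧ c₁ * x₀ + d₁ = c₂ * x₀ + d₂ ∧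
          EqTwoAffine u (comp (σ 1 ustar) l₁ x₀ ε) x₀ c₁ d₁ c₂ d₂)) := by
  obtain ⟨hw, hmem, hle⟩ := optimality hl₁ hl₂ hu hustar
  have h : IsOptimal l₁ l₂ u ustar := ⟨hmem, hle⟩
  refine ⟨hw, fun B hB x₀ _ => h.exists_polynomial hB x₀, fun A hA hΩ hsat => ?_,
    fun x₀ hx₀ ε hε h₁ => ⟨fun hσ => ?_, fun hσ => ?_⟩,
    fun x₀ hx₀ ε hε h₂ => ⟨fun hσ => ?_, fun hσ => ?_⟩⟩
  · filter_upwards [ae_eq_zero_of_saturated ustar hA hΩ hsat,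
      (ae_restrict_iff' measurableSet_Ω).1 (Lp.coeFn_sub u uδ)] with x h1 h2 hxA
    have h3 := h2 (hΩ hxA)
    rw [← hw, h1 hxA, Pi.sub_apply] at h3
    linarith
  · obtain ⟨hJ, c, d₁, d₂, hs, hu⟩ := h.jump_condition (s := 1) hx₀ hε h₁ (by simp) (by linarith)
    exact ⟨hJ, c, d₁, d₂, by linarith, hu⟩
  · obtain ⟨hJ, c, d₁, d₂, hs, hu⟩ := h.jump_condition (s := -1) hx₀ hε h₁ (by simp) (by linarith)
    exact ⟨hJ, c, d₁, d₂, by linarith, hu⟩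
  · obtain ⟨hJ, c₁, d₁, c₂, d₂, hs, hc, hu⟩ :=
      h.bending_condition (s := 1) hx₀ hε h₂ (by simp) (by linarith)
    exact ⟨hJ, c₁, d₁, c₂, d₂, by linarith, hc, hu⟩
  · obtain ⟨hJ, c₁, d₁, c₂, d₂, hs, hc, hu⟩ :=
      h.bending_condition (s := -1) hx₀ hε h₂ (by simp) (by linarith)
    exact ⟨hJ, c₁, d₁, c₂, d₂, by linarith, hc, hu⟩
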